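/- Let $M=(I,J,\{u_i^j\})$ be a market with a finite set $I$ of unit-demand buyers and a finite set $J$ of goods, where $u_i^j:\mathbb{R}\to\mathbb{R}$, the utility of buyer $i$ for receiving good $j$ as a function of its price, is continuous, strictly decreasing and onto $\mathbb{R}$; let $p_i^j$ be the inverse function of $u_i^j$. A competitive equilibrium $W$ of $M$ consists of a price vector $p(W)=\mathbf p\in\mathbb{R}_{\ge 0}^J$ and a payoff vector $u(W)=\mathbf u\in\mathbb{R}_{\ge 0}^I$ for which there is a supporting matching, that is, a (partial, one-to-one) matching $\mu$ of buyers to goods such that $\mathbf u_i= u_i^j(\mathbf p^j)$ if $j=\mu(i)$, $\mathbf u_i\ge u_i^j(\mathbf p^j)$ if $j\ne\mu(i)$, $\mathbf u_i=0$ for every unmatched buyer $i$, and $\mathbf p^j=0$ for every unmatched good $j$. Equilibria are ordered by $W\le W'$ iff $p(W)\le p(W')$ componentwise; the lowest (highest) equilibrium is the minimum (maximum) in this order. For a price vector $\mathbf p$ and a payoff vector $\mathbf u$ let $$u_i(\mathbf p)=\max\big(\{u_i^j(\mathbf p^j): j\in J\}\cup\{0\}\big),\qquad p^j(\mathbf u)=\max\big(\{p_i^j(\mathbf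 u_i): i\in I\}\cup\{0\}\big)$$ be the induced payoffs and the induced prices. Then $M$ has a competitive equilibrium, and it has a unique lowest competitive equilibrium $\underline W$ and a unique highest competitive equilibrium $\overline W$. For a buyer $i$ let $\overline W_{-i}$ be the highest competitive equilibrium of the market without $i$, and for a good $j$ let $\underline W^{-j}$ be the lowest competitive equilibrium of the market without $j$. For all $i\in I$ and $j\in J$: 1. (I) $u_i(\underline W)=u_i(p(\overline W_{-i}))$. 2. (II) $p^j(\overline W)=p^j(u(\underline W^{-j}))$. 3. (III) $p^j(\underline W)\le p^j(\overline W_{-i})$, with equality if $j=\mu(i)$ for some matching $\mu$ supporting $\underline W$. 4. (IV) $u_i(\overline W)\le u_i(\underline W^{-j})$, with equality if $j=\mu(i)$ for some matching $\mu$ supporting $\overline W$. Moreover, (I) and (II) fully characterize these equilibria: a pair $(\mathbf p,\mathbf u)\in\mathbb{R}^J\times\mathbb{R}^I$ is the lowest competitive equilibrium of $M$ if and only if $\mathbf u_i=u_i(p(\overline W_{-i}))$ for all $i$ and $\mathbf p^j=p^j(\mathbf u)$ for all $j$; it is the highest one if and only if $\mathbf p^j=p^j(u(\underline W^{-j}))$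 for all $j$ and $\mathbf u_i=u_i(\mathbf p)$ for all $i$. -/

import Mathlib

/-- A market with a set `I` of unit-demand buyers and a set `J` of goods: `utility i j x` is the
utility of buyer `i` for receiving good `j` at price `x`. Each utility function is a continuous,
strictly decreasing function from the whole real line onto the whole real line. -/
structure Market (I J : Type*) where
  utility : I → J → ℝ → ℝ
  continuous_utility : ∀ i j, Continuous (utility i j)
  strictAnti_utility : ∀ i j, StrictAnti (utility i j)
  surjective_utility : ∀ i j, Function.Surjective (utility i j)

/-- A price for every good together with a payoff for every buyer. -/
@[ext]
structure Outcome (I J : Type*) where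
  price : J → ℝ
  payoff : I → ℝ

namespace Market

/-- The matching `μ` supports the outcome `W`. A matching is a partial bijection between buyers and
goods; `j ∈ μ i` says that `i` is matched to `j`, `μ i = none` that buyer `i` is unmatched, and
`μ.symm j = none` that good `j` is unmatched. -/
structure Supports {I J : Type*} (M : Market I J) (μ : I ≃. J) (W : Outcome I J) : Prop where
  matched : ∀ i j, j ∈ μ i → W.payoff i = M.utility i j (W.price j)
  not_matched : ∀ i j, j ∉ μ i → M.utility i j (W.price j) ≤ W.payoff i
  unmatched_buyer : ∀ i, μ i = none → W.payoff i = 0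
  unmatched_good : ∀ j, μ.symm j = none → W.price j = 0
  payoff_nonneg : ∀ i, 0 ≤ W.payoff i
  price_nonneg : ∀ j, 0 ≤ W.price j

/-- `W` is a competitive equilibrium: it has a supporting matching. -/
def IsCompetitiveEquilibrium {I J : Type*} (M : Market I J) (W : Outcome I J) : Prop :=
  ∃ μ : I ≃. J, M.Supports μ W

/-- `W` is a lowest competitive equilibrium; equilibria are ordered by their price vectors. -/
def IsLowest {I J : Type*} (M : Market I J) (W : Outcome I J) : Prop :=
  M.IsCompetitiveEquilibrium W ∧ ∀ W', M.IsCompetitiveEquilibrium W' → W.price ≤ W'.price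

/-- `W` is a highest competitive equilibrium; equilibria are ordered by their price vectors. -/
def IsHighest {I J : Type*} (M : Market I J) (W : Outcome I J) : Prop :=
  M.IsCompetitiveEquilibrium W ∧ ∀ W', M.IsCompetitiveEquilibrium W' → W'.price ≤ W.price

/-- The price at which buyer `i` gets a given utility from good `j`: the inverse function of
`M.utility i j`. -/
noncomputable def inverseUtility {I J : Type*} (M : Market I J) (i : I) (j : J) : ℝ → ℝ :=
  (Equiv.ofBijective (M.utility i j)
    ⟨(M.strictAnti_utility i j).injective, M.surjective_utility i j⟩).symm

/-- The payoff of buyer `i` induced by the prices `p`. For finitely many goods the supremum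
is a maximum, see `isGreatest_inducedPayoff`. -/
noncomputable def inducedPayoff {I J : Type*} (M : Market I J) (p : J → ℝ) (i : I) : ℝ :=
  sSup (insert 0 (Set.range fun j => M.utility i j (p j)))

/-- The price of good `j` induced by the payoffs `u`. For finitely many buyers the supremum
is a maximum, see `isGreatest_inducedPrice`. -/
noncomputable def inducedPrice {I J : Type*} (M : Market I J) (u : I → ℝ) (j : J) : ℝ :=
  sSup (insert 0 (Set.range fun i => M.inverseUtility i j (u i)))

theorem isGreatest_inducedPayoff {I J : Type*} [Finite J] (M : Market I J) (p : J → ℝ) (i : I) :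
    IsGreatest (insert 0 (Set.range fun j => M.utility i j (p j))) (M.inducedPayoff p i) :=
  have h := (Set.finite_range fun j => M.utility i j (p j)).insert 0
  ⟨(Set.insert_nonempty _ _).csSup_mem h, fun _ hx => le_csSup h.bddAbove hx⟩

theorem isGreatest_inducedPrice {I J : Type*} [Finite I] (M : Market I J) (u : I → ℝ) (j : J) :
    IsGreatest (insert 0 (Set.range fun i => M.inverseUtility i j (u i))) (M.inducedPrice u j) :=
  have h := (Set.finite_range fun i => M.inverseUtility i j (u i)).insert 0
  ⟨(Set.insert_nonempty _ _).csSup_mem h, fun _ hx => le_csSup h.bddAbove hx⟩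

/-- The market without buyer `i`. -/
def removeBuyer {I J : Type*} (M : Market I J) (i : I) : Market {i' : I // i' ≠ i} J where
  utility i' j := M.utility i' j
  continuous_utility i' j := M.continuous_utility i' j
  strictAnti_utility i' j := M.strictAnti_utility i' j
  surjective_utility i' j := M.surjective_utility i' j

/-- The market without good `j`. -/
def removeGood {I J : Type*} (M : Market I J) (j : J) : Market I {j' : J // j' ≠ j} where
  utility i j' := M.utility i j'
  continuous_utility i j' := M.continuous_utility i j'
  strictAnti_utility i j' := M.strictAnti_utility i j'
  surjective_utility i j' := M.surjective_utility i j'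

end Market

/-! ### Inverse utilities and the dual market -/

namespace Market

variable {I J : Type*}

/-! Let `p` be the highest prices without buyer `i`, and `c` the payoff that `p` induces for `i`.
Give `i` an outside option worth `c` (`shift`): staying out is then optimal, so `p` is supported in
the shifted market with `i` unmatched. If `c > 0` and the option is worth slightly less than `c`,
then `i` is matched in every equilibrium; a limit gives an equilibrium with option `c` and `i`
matched (`exists_supports_shift`). Joining the two equilibria supports `p` with `i` matched, where
the option is irrelevant. Hence `p` is an equilibrium price vector of the full market
(`exists_isCompetitiveEquilibrium_price_eq`).

So the lowest prices are at most `p`, and `i` gets at least `c` at them. The opposite bound, and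
equality of prices at the good of `i`, come from the decomposition lemma
`Supports.exists_mem_of_payoff_lt_right`, applied in the shifted market. The claims on highest
equilibria follow by exchanging buyers and goods (`dual`).

Existence comes from an ascending auction with increment `ε → 0`; a highest equilibrium maximizes
the total price, by `Supports.join`. -/

theorem utility_inverseUtility (M : Market I J) (i : I) (j : J) (x : ℝ) :
    M.utility i j (M.inverseUtility i j x) = x :=
  (Equiv.ofBijective (M.utility i j)
    ⟨(M.strictAnti_utility i j).injective, M.surjective_utility i j⟩).apply_symm_apply x

theorem inverseUtility_utility (M : Market I J) (i : I) (j : J) (x : ℝ) :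
    M.inverseUtility i j (M.utility i j x) = x :=
  (Equiv.ofBijective (M.utility i j)
    ⟨(M.strictAnti_utility i j).injective, M.surjective_utility i j⟩).symm_apply_apply x

theorem utility_le_iff (M : Market I J) (i : I) (j : J) (x y : ℝ) :
    M.utility i j x ≤ y ↔ M.inverseUtility i j y ≤ x := by
  conv_lhs => rw [← M.utility_inverseUtility i j y]
  exact (M.strictAnti_utility i j).le_iff_ge

theorem le_utility_iff (M : Market I J) (i : I) (j : J) (x y : ℝ) :
    y ≤ M.utility i j x ↔ x ≤ M.inverseUtility i j y := by
  conv_lhs => rw [← M.utility_inverseUtility i j y]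
  exact (M.strictAnti_utility i j).le_iff_ge

theorem strictAnti_inverseUtility (M : Market I J) (i : I) (j : J) :
    StrictAnti (M.inverseUtility i j) := fun x y h => by
  rw [← M.utility_inverseUtility i j x, ← M.utility_inverseUtility i j y] at h
  exact (M.strictAnti_utility i j).lt_iff_gt.1 h

theorem surjective_inverseUtility (M : Market I J) (i : I) (j : J) :
    Function.Surjective (M.inverseUtility i j) :=
  fun x => ⟨_, M.inverseUtility_utility i j x⟩

/-- The market in which the roles of buyers and goods are exchanged. -/
noncomputable def dual (M : Market I J) : Market J I where
  utility j i := M.inverseUtility i j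
  continuous_utility j i := by
    have hs : Function.Surjective fun x => -M.inverseUtility i j x := fun y => by
      obtain ⟨x, hx⟩ := M.surjective_inverseUtility i j (-y)
      exact ⟨x, by simp [hx]⟩
    -- A monotone surjection onto the line is continuous; the sign turns antitone into monotone.
    have h : Continuous fun x => -M.inverseUtility i j x :=
      (M.strictAnti_inverseUtility i j).antitone.neg.continuous_of_surjective hs
    exact continuous_neg_iff.1 h
  strictAnti_utility j i := M.strictAnti_inverseUtility i j
  surjective_utility j i := M.surjective_inverseUtility i j

theorem inverseUtility_dual (M : Market I J) (i : I) (j : J) :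
    M.dual.inverseUtility j i = M.utility i j := by
  ext x
  apply (M.dual.strictAnti_utility j i).injective
  rw [M.dual.utility_inverseUtility]
  exact (M.inverseUtility_utility i j x).symm

theorem inducedPrice_dual (M : Market I J) (p : J → ℝ) (i : I) :
    M.dual.inducedPrice p i = M.inducedPayoff p i := by
  simp only [inducedPrice, inducedPayoff, inverseUtility_dual]

end Market

/-- The outcome in which the roles of buyers and goods are exchanged. -/
def Outcome.swap {I J : Type*} (W : Outcome I J) : Outcome J I := ⟨W.payoff, W.price⟩

/-! ### Comparing two equilibria -/

namespace Market

variable {I J : Type*} {M : Market I J} {μ μ₁ μ₂ : I ≃. J} {W W₁ W₂ : Outcome I J}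

namespace Supports

theorem utility_le_payoff (h : M.Supports μ W) (i : I) (j : J) :
    M.utility i j (W.price j) ≤ W.payoff i := by
  by_cases hj : j ∈ μ i
  · exact (h.matched i j hj).ge
  · exact h.not_matched i j hj

theorem dual (h : M.Supports μ W) : M.dual.Supports μ.symm W.swap where
  matched j i hi := by
    have := h.matched i j ((μ.mem_iff_mem).1 hi)
    change W.price j = M.inverseUtility i j (W.payoff i)
    rw [this, M.inverseUtility_utility]
  not_matched j i _ := (M.utility_le_iff i j _ _).1 (h.utility_le_payoff i j)
  unmatched_buyer := h.unmatched_good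
  unmatched_good := h.unmatched_buyer
  payoff_nonneg := h.price_nonneg
  price_nonneg := h.payoff_nonneg

theorem of_dual {ν : J ≃. I} {W : Outcome J I} (h : M.dual.Supports ν W) :
    M.Supports ν.symm W.swap where
  matched i j hj := by
    have := h.matched j i ((ν.mem_iff_mem).1 hj)
    change W.price i = M.utility i j (W.payoff j)
    rw [this]
    exact (M.utility_inverseUtility i j _).symm
  not_matched i j _ := (M.utility_le_iff i j _ _).2 (h.utility_le_payoff j i)
  unmatched_buyer := h.unmatched_good
  unmatched_good := h.unmatched_buyer
  payoff_nonneg := h.price_nonneg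
  price_nonneg := h.payoff_nonneg

theorem payoff_eq_inducedPayoff [Finite J] (h : M.Supports μ W) (i : I) :
    W.payoff i = M.inducedPayoff W.price i := by
  refine IsGreatest.unique ⟨?_, ?_⟩ (M.isGreatest_inducedPayoff W.price i)
  · rcases hi : μ i with _ | j
    · exact Or.inl (h.unmatched_buyer i hi)
    · exact Or.inr ⟨j, (h.matched i j hi).symm⟩
  · rintro _ (rfl | ⟨j, rfl⟩)
    · exact h.payoff_nonneg i
    · exact h.utility_le_payoff i j

theorem payoff_lt_of_price_lt (h₁ : M.Supports μ₁ W₁) (h₂ : M.Supports μ₂ W₂) {i : I} {j : J}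
    (hj : j ∈ μ₂ i) (h : W₁.price j < W₂.price j) : W₂.payoff i < W₁.payoff i :=
  ((h₂.matched i j hj).trans_lt (M.strictAnti_utility i j h)).trans_le (h₁.utility_le_payoff i j)

theorem price_lt_of_payoff_lt (h₁ : M.Supports μ₁ W₁) (h₂ : M.Supports μ₂ W₂) {i : I} {j : J}
    (hj : j ∈ μ₁ i) (h : W₂.payoff i < W₁.payoff i) : W₁.price j < W₂.price j :=
  (M.strictAnti_utility i j).lt_iff_gt.1
    (((h₂.utility_le_payoff i j).trans_lt h).trans_eq (h₁.matched i j hj))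

theorem exists_mem_of_payoff_lt_left (h₁ : M.Supports μ₁ W₁) (h₂ : M.Supports μ₂ W₂) {i : I}
    (h : W₂.payoff i < W₁.payoff i) : ∃ j ∈ μ₁ i, W₁.price j < W₂.price j := by
  rcases hi : μ₁ i with _ | j
  · exact absurd ((h₂.payoff_nonneg i).trans_lt h) (h₁.unmatched_buyer i hi).not_gt
  · exact ⟨j, rfl, h₁.price_lt_of_payoff_lt h₂ hi h⟩

theorem exists_mem_of_price_lt_right (h₁ : M.Supports μ₁ W₁) (h₂ : M.Supports μ₂ W₂) {j : J}
    (h : W₁.price j < W₂.price j) : ∃ i, j ∈ μ₂ i ∧ W₂.payoff i < W₁.payoff i := by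
  rcases hj : μ₂.symm j with _ | i
  · exact absurd ((h₁.price_nonneg j).trans_lt h) (h₂.unmatched_good j hj).not_gt
  · have hj' : j ∈ μ₂ i := (μ₂.mem_iff_mem).1 hj
    exact ⟨i, hj', h₁.payoff_lt_of_price_lt h₂ hj' h⟩

/-- The buyers who prefer `W₁` to `W₂` receive, in both outcomes, exactly the goods whose price is
lower in `W₁` than in `W₂`. -/
theorem exists_mem_of_payoff_lt_right [Finite I] (h₁ : M.Supports μ₁ W₁) (h₂ : M.Supports μ₂ W₂)
    {i : I} (h : W₂.payoff i < W₁.payoff i) : ∃ j ∈ μ₂ i, W₁.price j < W₂.price j := by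
  choose f hf hf' using fun i : {i // W₂.payoff i < W₁.payoff i} =>
    h₁.exists_mem_of_payoff_lt_left h₂ i.2
  choose g hg hg' using fun j : {j // W₁.price j < W₂.price j} =>
    h₁.exists_mem_of_price_lt_right h₂ j.2
  -- Going to the good under `μ₁` and back to its buyer under `μ₂` is an injective self-map of a
  -- finite set, hence onto.
  let k : {i // W₂.payoff i < W₁.payoff i} → {i // W₂.payoff i < W₁.payoff i} :=
    fun i => ⟨g ⟨f i, hf' i⟩, hg' _⟩
  have hk : Function.Injective k := fun a b hab => by
    have hab' : g ⟨f a, hf' a⟩ = g ⟨f b, hf' b⟩ := congrArg Subtype.val hab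
    have e : f a = f b := Option.mem_unique (hg ⟨f a, hf' a⟩) (hab' ▸ hg ⟨f b, hf' b⟩)
    exact Subtype.ext (μ₁.inj (hf a) (e ▸ hf b))
  obtain ⟨a, ha⟩ := Finite.surjective_of_injective hk ⟨i, h⟩
  have ha' : g ⟨f a, hf' a⟩ = i := congrArg Subtype.val ha
  exact ⟨f a, ha' ▸ hg ⟨f a, hf' a⟩, hf' a⟩

theorem exists_mem_of_price_lt_left [Finite J] (h₁ : M.Supports μ₁ W₁) (h₂ : M.Supports μ₂ W₂)
    {j : J} (h : W₁.price j < W₂.price j) : ∃ i, j ∈ μ₁ i ∧ W₂.payoff i < W₁.payoff i := by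
  obtain ⟨i, hi, hi'⟩ := h₂.dual.exists_mem_of_payoff_lt_right h₁.dual h
  exact ⟨i, (μ₁.mem_iff_mem).1 hi, hi'⟩

/-- The componentwise maximum of two supported price vectors is supported, by a matching which
agrees with the first one for the buyers who do not prefer the first outcome. -/
theorem join [Finite I] [Finite J] (h₁ : M.Supports μ₁ W₁) (h₂ : M.Supports μ₂ W₂) :
    ∃ μ : I ≃. J, (∀ i, W₁.payoff i ≤ W₂.payoff i → μ i = μ₁ i) ∧
      M.Supports μ ⟨W₁.price ⊔ W₂.price, W₁.payoff ⊓ W₂.payoff⟩ := by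
  classical
  let μ : I ≃. J :=
    { toFun := fun i => if W₂.payoff i < W₁.payoff i then μ₂ i else μ₁ i
      invFun := fun j => if W₁.price j < W₂.price j then μ₂.symm j else μ₁.symm j
      inv := fun i j => by
        -- Along either matching, the case split on buyers agrees with the one on goods, so the
        -- pieces glue to a matching.
        have key₂ : j ∈ μ₂ i → (W₁.price j < W₂.price j ↔ W₂.payoff i < W₁.payoff i) :=
          fun hj => ⟨h₁.payoff_lt_of_price_lt h₂ hj, fun h => by
            obtain ⟨j', hj', hlt⟩ := h₁.exists_mem_of_payoff_lt_right h₂ h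
            exact Option.mem_unique hj' hj ▸ hlt⟩
        have key₁ : j ∈ μ₁ i → (W₁.price j < W₂.price j ↔ W₂.payoff i < W₁.payoff i) :=
          fun hj => ⟨fun h => by
            obtain ⟨i', hj', hlt⟩ := h₁.exists_mem_of_price_lt_left h₂ h
            exact μ₁.inj hj' hj ▸ hlt, h₁.price_lt_of_payoff_lt h₂ hj⟩
        have e₁ := μ₁.mem_iff_mem (a := i) (b := j)
        have e₂ := μ₂.mem_iff_mem (a := i) (b := j)
        split_ifs <;> tauto }
  have hμ : ∀ i, μ i = if W₂.payoff i < W₁.payoff i then μ₂ i else μ₁ i := fun _ => rfl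
  have hμ' : ∀ j, μ.symm j = if W₁.price j < W₂.price j then μ₂.symm j else μ₁.symm j :=
    fun _ => rfl
  refine ⟨μ, fun i hi => by rw [hμ, if_neg hi.not_gt], ?_, ?_, ?_, ?_, ?_, ?_⟩
  · intro i j hj
    have hj' := (μ.mem_iff_mem).2 hj
    rw [hμ] at hj
    rw [hμ'] at hj'
    simp only [Pi.inf_apply, Pi.sup_apply]
    split_ifs at hj with hi
    · have hlt : W₁.price j < W₂.price j := by
        obtain ⟨j', hj', hlt⟩ := h₁.exists_mem_of_payoff_lt_right h₂ hi
        exact Option.mem_unique hj' hj ▸ hlt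
      rw [inf_eq_right.2 hi.le, sup_eq_right.2 hlt.le, h₂.matched i j hj]
    · have hle : ¬ W₁.price j < W₂.price j := fun h => by
        obtain ⟨i', hj', hlt⟩ := h₁.exists_mem_of_price_lt_left h₂ h
        exact hi (μ₁.inj hj' hj ▸ hlt)
      rw [inf_eq_left.2 (not_lt.1 hi), sup_eq_left.2 (not_lt.1 hle), h₁.matched i j hj]
  · intro i j _
    exact le_inf
      (((M.strictAnti_utility i j).antitone le_sup_left).trans (h₁.utility_le_payoff i j))
      (((M.strictAnti_utility i j).antitone le_sup_right).trans (h₂.utility_le_payoff i j))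
  · intro i hi
    rw [hμ] at hi
    simp only [Pi.inf_apply]
    split_ifs at hi with h
    · rw [inf_eq_right.2 h.le, h₂.unmatched_buyer i hi]
    · rw [inf_eq_left.2 (not_lt.1 h), h₁.unmatched_buyer i hi]
  · intro j hj
    rw [hμ'] at hj
    simp only [Pi.sup_apply]
    split_ifs at hj with h
    · rw [sup_eq_right.2 h.le, h₂.unmatched_good j hj]
    · rw [sup_eq_left.2 (not_lt.1 h), h₁.unmatched_good j hj]
  · exact fun i => le_inf (h₁.payoff_nonneg i) (h₂.payoff_nonneg i)
  · exact fun j => (h₁.price_nonneg j).trans le_sup_left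

end Supports

end Market

/-! ### Outside options, and existence by an approximate auction -/

namespace Market

variable {I J : Type*}

/-- The market in which the utilities of buyer `i` are lowered by `r i`, that is, buyer `i` has an
outside option of value `r i`. -/
def shift (M : Market I J) (r : I → ℝ) : Market I J where
  utility i j x := M.utility i j x - r i
  continuous_utility i j := (M.continuous_utility i j).sub continuous_const
  strictAnti_utility i j _ _ h := sub_lt_sub_right (M.strictAnti_utility i j h) _
  surjective_utility i j y := by
    obtain ⟨x, hx⟩ := M.surjective_utility i j (y + r i)
    exact ⟨x, by simp [hx]⟩

theorem shift_zero (M : Market I J) : M.shift 0 = M := by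
  cases M
  simp [shift]

/-- The prices `p` are supported by `μ` up to price increments `ε`, when buyers have the outside
options `r`, except that unmatched buyers may want to buy a good. -/
structure TentativelySupports (M : Market I J) (r : I → ℝ) (ε : ℝ) (μ : I ≃. J) (p : J → ℝ) :
    Prop where
  price_nonneg : ∀ j, 0 ≤ p j
  unmatched_good : ∀ j, μ.symm j = none → p j = 0
  le_utility : ∀ i j, j ∈ μ i → r i ≤ M.utility i j (p j)
  utility_le : ∀ i j, j ∈ μ i → ∀ j', M.utility i j' (p j' + ε) ≤ M.utility i j (p j)

/-- The prices `p` are supported by `μ` up to price increments `ε`, when buyers have the outside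
options `r`. -/
structure ApproxSupports (M : Market I J) (r : I → ℝ) (ε : ℝ) (μ : I ≃. J) (p : J → ℝ) : Prop
    extends M.TentativelySupports r ε μ p where
  unmatched_buyer : ∀ i, μ i = none → ∀ j, M.utility i j (p j + ε) ≤ r i

theorem Supports.approxSupports {M : Market I J} {r : I → ℝ} {μ : I ≃. J} {W : Outcome I J}
    (h : (M.shift r).Supports μ W) : M.ApproxSupports r 0 μ W.price where
  price_nonneg := h.price_nonneg
  unmatched_good := h.unmatched_good
  le_utility i j hj := by
    have := h.matched i j hj ▸ h.payoff_nonneg i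
    exact sub_nonneg.1 this
  utility_le i j hj j' := by
    have := h.matched i j hj ▸ h.utility_le_payoff i j'
    rw [add_zero]
    exact (sub_le_sub_iff_right (r i)).1 this
  unmatched_buyer i hi j := by
    have := h.unmatched_buyer i hi ▸ h.utility_le_payoff i j
    rw [add_zero]
    exact sub_nonpos.1 this

theorem ApproxSupports.exists_supports {M : Market I J} {r : I → ℝ} {μ : I ≃. J} {p : J → ℝ}
    (h : M.ApproxSupports r 0 μ p) : ∃ u, (M.shift r).Supports μ ⟨p, u⟩ := by
  have key : ∀ i, ∃ x : ℝ, 0 ≤ x ∧ (∀ j ∈ μ i, x = M.utility i j (p j) - r i) ∧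
      (∀ j, M.utility i j (p j) - r i ≤ x) ∧ (μ i = none → x = 0) := fun i => by
    rcases hi : μ i with _ | j
    · exact ⟨0, le_rfl, by simp, fun j => by simpa using h.unmatched_buyer i hi j, fun _ => rfl⟩
    · refine ⟨M.utility i j (p j) - r i, sub_nonneg.2 (h.le_utility i j hi), ?_, fun j' => ?_, ?_⟩
      · intro j' hj'
        rw [Option.mem_some_iff.1 hj']
      · simpa using h.utility_le i j hi j'
      · simp
  choose u h0 hm hle hn using key
  exact ⟨u, ⟨hm, fun i j _ => hle i j, hn, h.unmatched_good, h0, h.price_nonneg⟩⟩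

theorem isClosed_setOf_approxSupports {X : Type*} [TopologicalSpace X] (M : Market I J)
    {r : X → I → ℝ} {ε : X → ℝ} {p : X → J → ℝ} (hr : Continuous r) (hε : Continuous ε)
    (hp : Continuous p) (μ : I ≃. J) : IsClosed {x | M.ApproxSupports (r x) (ε x) μ (p x)} := by
  have hr' : ∀ i, Continuous fun x => r x i := fun i => (continuous_apply i).comp hr
  have hp' : ∀ j, Continuous fun x => p x j := fun j => (continuous_apply j).comp hp
  have hu : ∀ i j, Continuous fun x => M.utility i j (p x j) := fun i j =>
    (M.continuous_utility i j).comp (hp' j)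
  have hv : ∀ i j, Continuous fun x => M.utility i j (p x j + ε x) := fun i j =>
    (M.continuous_utility i j).comp ((hp' j).add hε)
  have : {x | M.ApproxSupports (r x) (ε x) μ (p x)} =
      {x | (∀ j, 0 ≤ p x j) ∧ (∀ j, μ.symm j = none → p x j = 0) ∧
        (∀ i j, j ∈ μ i → r x i ≤ M.utility i j (p x j)) ∧
        (∀ i j, j ∈ μ i → ∀ j', M.utility i j' (p x j' + ε x) ≤ M.utility i j (p x j)) ∧
        (∀ i, μ i = none → ∀ j, M.utility i j (p x j + ε x) ≤ r x i)} := by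
    ext x
    exact ⟨fun ⟨⟨a, b, c, d⟩, e⟩ => ⟨a, b, c, d, e⟩, fun ⟨a, b, c, d, e⟩ => ⟨⟨a, b, c, d⟩, e⟩⟩
  rw [this]
  simp only [Set.ofPred_and, Set.ofPred_forall]
  refine (isClosed_iInter fun j => isClosed_le continuous_const (hp' j)).inter
    ((isClosed_iInter fun j => isClosed_iInter fun _ => isClosed_eq (hp' j) continuous_const).inter
    ((isClosed_iInter fun i => isClosed_iInter fun j => isClosed_iInter fun _ =>
      isClosed_le (hr' i) (hu i j)).inter
    ((isClosed_iInter fun i => isClosed_iInter fun j => isClosed_iInter fun _ =>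
      isClosed_iInter fun j' => isClosed_le (hv i j') (hu i j)).inter
    (isClosed_iInter fun i => isClosed_iInter fun _ => isClosed_iInter fun j =>
      isClosed_le (hv i j) (hr' i)))))

/-- An unmatched good is free, and the owner of a matched good still gets at least `r₀`. Uniformity
in `r`, `ε` and `μ` makes the auction stop and supplies the compact boxes for the limits. -/
theorem exists_price_bound [Finite I] [Finite J] (M : Market I J) (r₀ : I → ℝ) :
    ∃ B : ℝ, ∀ r ε μ p, r₀ ≤ r → M.TentativelySupports r ε μ p → ∀ j, p j ≤ B := by
  obtain ⟨B, hB⟩ := (Set.finite_range fun x : I × J => M.inverseUtility x.1 x.2 (r₀ x.1)).bddAbove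
  refine ⟨max B 0, fun r ε μ p hr h j => ?_⟩
  rcases hj : μ.symm j with _ | i
  · exact (h.unmatched_good j hj).trans_le (le_max_right _ _)
  · have := (hr i).trans (h.le_utility i j ((μ.mem_iff_mem).1 hj))
    exact ((M.le_utility_iff i j _ _).1 this).trans
      ((hB ⟨(i, j), rfl⟩).trans (le_max_left _ _))

/-- The matching obtained from `μ` by matching the unmatched buyer `i` to `j`. -/
theorem _root_.PEquiv.exists_insert {μ : I ≃. J} {i : I} (hi : μ i = none) (j : J) :
    ∃ ν : I ≃. J, (∀ i' j', j' ∈ ν i' → i' = i ∧ j' = j ∨ j' ≠ j ∧ j' ∈ μ i') ∧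
      ∀ j', ν.symm j' = none → j' ≠ j ∧ μ.symm j' = none := by
  classical
  let ν : I ≃. J :=
    { toFun := fun i' => if i' = i then some j else if j ∈ μ i' then none else μ i'
      invFun := fun j' => if j' = j then some i else μ.symm j'
      inv := fun i' j' => by
        have e : μ.symm j' = some i' ↔ μ i' = some j' := μ.mem_iff_mem
        have e' : μ i' = some j' → μ i' = some j → j' = j := fun h h' => Option.mem_unique h h'
        simp only [Option.mem_def]
        split_ifs <;> grind }
  have hν : ∀ i', ν i' = if i' = i then some j else if j ∈ μ i' then none else μ i' :=
    fun _ => rfl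
  have hν' : ∀ j', ν.symm j' = if j' = j then some i else μ.symm j' := fun _ => rfl
  refine ⟨ν, fun i' j' h => ?_, fun j' h => ?_⟩
  · rw [hν] at h
    split_ifs at h with h1 h2
    · exact Or.inl ⟨h1, (Option.mem_some_iff.1 h).symm⟩
    · simp at h
    · exact Or.inr ⟨fun e => h2 (e ▸ h), h⟩
  · rw [hν'] at h
    split_ifs at h with h1
    exact ⟨h1, h⟩

/-- One step of an ascending auction: an unmatched buyer with a profitable bid increases the price
of a good by `ε`. -/
theorem TentativelySupports.exists_bid [Finite J] {M : Market I J} {r : I → ℝ} {ε : ℝ}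
    {μ : I ≃. J} {p : J → ℝ} (h : M.TentativelySupports r ε μ p) (hε : 0 ≤ ε) {i : I}
    (hi : μ i = none) (hr : ∃ j, r i < M.utility i j (p j + ε)) :
    ∃ j ν q, M.TentativelySupports r ε ν q ∧ q j = p j + ε ∧ ∀ j', j' ≠ j → q j' = p j' := by
  classical
  obtain ⟨j₀, hj₀⟩ := hr
  have : Nonempty J := ⟨j₀⟩
  -- Bidding on the best good at the raised prices makes the new match optimal up to `ε`; a
  -- displaced owner becomes unmatched, which a tentative support allows.
  obtain ⟨j, hj⟩ := Finite.exists_max fun j => M.utility i j (p j + ε)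
  obtain ⟨ν, hν, hνg⟩ := PEquiv.exists_insert hi j
  have hpq : ∀ j', p j' ≤ Function.update p j (p j + ε) j' := fun j' => by
    rcases eq_or_ne j' j with rfl | hne
    · simpa using hε
    · simp [hne]
  refine ⟨j, ν, Function.update p j (p j + ε), ⟨fun j' => (h.price_nonneg j').trans (hpq j'),
    fun j' hj' => ?_, fun i' j' hj' => ?_, fun i' j' hj' j'' => ?_⟩, by simp,
    fun j' hj' => by simp [hj']⟩
  · obtain ⟨h1, h2⟩ := hνg j' hj'
    simpa [h1] using h.unmatched_good j' h2
  · rcases hν i' j' hj' with ⟨rfl, rfl⟩ | ⟨h1, h2⟩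
    · simpa using hj₀.le.trans (hj j₀)
    · simpa [h1] using h.le_utility i' j' h2
  · have hle := (M.strictAnti_utility i' j'').antitone (add_le_add_left (hpq j'') ε)
    refine hle.trans ?_
    rcases hν i' j' hj' with ⟨rfl, rfl⟩ | ⟨h1, h2⟩
    · simpa using hj j''
    · simpa [h1] using h.utility_le i' j' h2 j''

/-- The final state of the auction is found as a tentative support, with prices in `ε ℕ`, whose
total number of increments is maximal: one more bid would raise that number by one. -/
theorem exists_approxSupports_of_pos [Finite I] [Finite J] (M : Market I J) (r : I → ℝ) {ε : ℝ}
    (hε : 0 < ε) : ∃ μ p, M.ApproxSupports r ε μ p := by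
  classical
  cases nonempty_fintype J
  obtain ⟨B, hB⟩ := M.exists_price_bound r
  let S : Set ℕ := {n | ∃ (k : J → ℕ) (μ : I ≃. J),
    M.TentativelySupports r ε μ (fun j => ε * k j) ∧ ∑ j, k j = n}
  have h0 : S.Nonempty := ⟨0, fun _ => 0, ⊥, ⟨by simp, by simp, by simp, by simp⟩, by simp⟩
  have hS : BddAbove S := by
    refine ⟨∑ _j : J, ⌈B / ε⌉₊, ?_⟩
    rintro _ ⟨k, μ, h, rfl⟩
    refine Finset.sum_le_sum fun j _ => ?_
    have : (k j : ℝ) ≤ B / ε := (le_div_iff₀' hε).2 (hB r ε μ _ le_rfl h j)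
    exact_mod_cast this.trans (Nat.le_ceil _)
  obtain ⟨k, μ, h, hk⟩ := Nat.sSup_mem h0 hS
  refine ⟨μ, _, h, fun i hi => ?_⟩
  by_contra! hr
  obtain ⟨j, ν, q, hq, hj, hne⟩ := h.exists_bid hε.le hi hr
  have hq' : q = fun j' => ε * (Function.update k j (k j + 1) j' : ℕ) := by
    ext j'
    rcases eq_or_ne j' j with rfl | h'
    · rw [hj]
      simp [mul_add]
    · simp [hne j' h', h']
  have := le_csSup hS ⟨Function.update k j (k j + 1), ν, hq' ▸ hq, rfl⟩
  rw [← hk, Finset.sum_update_of_mem (Finset.mem_univ j),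
    ← Finset.add_sum_erase _ _ (Finset.mem_univ j), Finset.sdiff_singleton_eq_erase] at this
  omega

/-- A family of closed conditions, one of which can be met in a compact set for all small
positive `ε`, can also be met for `ε = 0`. -/
theorem exists_mem_zero_of_pos {ι X : Type*} [Finite ι] [TopologicalSpace X] {K : Set X}
    (hK : IsCompact K) {C : ι → Set (ℝ × X)} (hC : ∀ m, IsClosed (C m))
    (h : ∀ ε, 0 < ε → ε ≤ 1 → ∃ m, ∃ x ∈ K, (ε, x) ∈ C m) : ∃ m, ∃ x, (0, x) ∈ C m := by
  -- The feasible `ε` form a finite union of projections of compact sets.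
  have hcl : IsClosed (⋃ m, Prod.fst '' (Set.Icc (0 : ℝ) 1 ×ˢ K ∩ C m)) :=
    isClosed_iUnion_of_finite fun m =>
      (((isCompact_Icc.prod hK).inter_right (hC m)).image continuous_fst).isClosed
  have hsub : Set.Ioc (0 : ℝ) 1 ⊆ ⋃ m, Prod.fst '' (Set.Icc (0 : ℝ) 1 ×ˢ K ∩ C m) :=
    fun ε hε => by
      obtain ⟨m, x, hx, hm⟩ := h ε hε.1 hε.2
      exact Set.mem_iUnion.2 ⟨m, (ε, x), ⟨⟨Set.Ioc_subset_Icc_self hε, hx⟩, hm⟩, rfl⟩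
  have h0 : (0 : ℝ) ∈ closure (Set.Ioc (0 : ℝ) 1) := by
    rw [closure_Ioc zero_ne_one]
    exact ⟨le_rfl, zero_le_one⟩
  obtain ⟨m, ⟨t, x⟩, ⟨-, hm⟩, rfl⟩ := Set.mem_iUnion.1 (hcl.closure_subset_iff.2 hsub h0)
  exact ⟨m, x, hm⟩

instance _root_.PEquiv.finite [Finite I] [Finite J] : Finite (I ≃. J) :=
  Finite.of_injective (fun μ : I ≃. J => (μ : I → Option J)) DFunLike.coe_injective

theorem exists_approxSupports [Finite I] [Finite J] (M : Market I J) (r : I → ℝ) :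
    ∃ μ p, M.ApproxSupports r 0 μ p := by
  obtain ⟨B, hB⟩ := M.exists_price_bound r
  refine exists_mem_zero_of_pos (K := Set.Icc 0 fun _ => B)
    (C := fun μ => {x : ℝ × (J → ℝ) | M.ApproxSupports r x.1 μ x.2}) isCompact_Icc
    (M.isClosed_setOf_approxSupports continuous_const continuous_fst continuous_snd)
    fun ε hε _ => ?_
  obtain ⟨μ, p, h⟩ := M.exists_approxSupports_of_pos r hε
  exact ⟨μ, p, ⟨h.price_nonneg, hB r ε μ p le_rfl h.toTentativelySupports⟩, h⟩

theorem exists_isHighest [Finite I] [Finite J] (M : Market I J) : ∃ W, M.IsHighest W := by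
  cases nonempty_fintype J
  obtain ⟨B, hB⟩ := M.exists_price_bound 0
  let K : Set (J → ℝ) := ⋃ μ : I ≃. J, {p | M.ApproxSupports 0 0 μ p}
  have hK : IsCompact K := by
    refine (isCompact_Icc (a := (0 : J → ℝ)) (b := fun _ => B)).of_isClosed_subset
      (isClosed_iUnion_of_finite fun μ =>
        M.isClosed_setOf_approxSupports continuous_const continuous_const continuous_id μ) ?_
    refine Set.iUnion_subset fun μ p h => ?_
    exact ⟨h.price_nonneg, hB 0 0 μ p le_rfl h.toTentativelySupports⟩
  have hne : K.Nonempty := by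
    obtain ⟨μ, p, h⟩ := M.exists_approxSupports 0
    exact ⟨p, Set.mem_iUnion.2 ⟨μ, h⟩⟩
  obtain ⟨p, hp, hmax⟩ := hK.exists_isMaxOn hne (f := fun p : J → ℝ => ∑ j, p j)
    (by fun_prop)
  obtain ⟨μ, hμ⟩ := Set.mem_iUnion.1 hp
  obtain ⟨u, hu⟩ := hμ.exists_supports
  rw [shift_zero] at hu
  refine ⟨⟨p, u⟩, ⟨μ, hu⟩, ?_⟩
  rintro W ⟨ν, hν⟩ j
  obtain ⟨ξ, -, hξ⟩ := hu.join hν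
  rw [← M.shift_zero] at hξ
  have hmem : p ⊔ W.price ∈ K := Set.mem_iUnion.2 ⟨ξ, hξ.approxSupports⟩
  -- Otherwise the join with `W` would have a larger total price.
  by_contra! hlt
  exact (Finset.sum_lt_sum (fun j _ => le_sup_left)
    ⟨j, Finset.mem_univ j, lt_sup_iff.2 (Or.inr hlt)⟩).not_ge (hmax hmem)

end Market

/-! ### Removing a buyer, and induced payoffs -/

namespace Market

variable {I J : Type*}

section RemoveBuyer

/-- A matching without buyer `i`, as a matching of all buyers. -/
theorem _root_.PEquiv.exists_extend {i : I} (ν : {i' : I // i' ≠ i} ≃. J) :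
    ∃ μ : I ≃. J, μ i = none ∧ (∀ i' : {i' : I // i' ≠ i}, μ i' = ν i') ∧
      ∀ j, μ.symm j = none → ν.symm j = none := by
  classical
  refine ⟨⟨fun i' => if h : i' ≠ i then ν ⟨i', h⟩ else none, fun j => (ν.symm j).map Subtype.val,
    fun i' j => ?_⟩, by simp, fun i' => by simp [i'.2], fun j hj => ?_⟩
  · by_cases h : i' = i
    · subst h
      simp only [Option.map_eq_some_iff]
      simp
    · have e : ν.symm j = some ⟨i', h⟩ ↔ ν ⟨i', h⟩ = some j := ν.mem_iff_mem
      simp only [Option.map_eq_some_iff]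
      simp [h, ← e]
  · exact Option.map_eq_none_iff.1 hj

/-- A matching which leaves buyer `i` unmatched, as a matching of the other buyers. -/
theorem _root_.PEquiv.exists_restrict {i : I} {μ : I ≃. J} (hi : μ i = none) :
    ∃ ν : {i' : I // i' ≠ i} ≃. J, (∀ i' : {i' : I // i' ≠ i}, ν i' = μ i') ∧
      ∀ j, ν.symm j = none → μ.symm j = none := by
  classical
  have hne : ∀ {i' j}, μ.symm j = some i' → i' ≠ i := by
    rintro _ j h rfl
    have : j ∈ μ _ := (μ.mem_iff_mem).1 h
    simp [hi] at this
  refine ⟨⟨fun i' => μ i', fun j => (μ.symm j).bind fun i' => if h : i' ≠ i then some ⟨i', h⟩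
    else none, fun i' j => ?_⟩, fun _ => rfl, fun j hj => ?_⟩
  · have e : μ.symm j = some i'.1 ↔ μ i' = some j := μ.mem_iff_mem
    refine Iff.trans ?_ e
    rcases h : μ.symm j with _ | a
    · simp
    · simp [hne h, Subtype.ext_iff]
  · rcases h : μ.symm j with _ | a
    · rfl
    · exfalso
      change (μ.symm j).bind _ = none at hj
      simp [h, hne h] at hj

variable [DecidableEq I] {M : Market I J} {i : I} {c : ℝ}

/-- An outside option binds only an unmatched buyer; for a matched one it merely translates the
payoff. -/
theorem Supports.of_shift_single {μ : I ≃. J} {W : Outcome I J}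
    (h : (M.shift (Pi.single i c)).Supports μ W) (hc : 0 ≤ c) (hi : μ i ≠ none) :
    M.Supports μ ⟨W.price, W.payoff + Pi.single i c⟩ where
  matched i' j hj := by
    simp only [Pi.add_apply, h.matched i' j hj]
    exact sub_add_cancel _ _
  not_matched i' j hj := sub_le_iff_le_add.1 (h.not_matched i' j hj)
  unmatched_buyer i' hi' := by
    have : i' ≠ i := fun e => hi (e ▸ hi')
    simp [h.unmatched_buyer i' hi', this]
  unmatched_good := h.unmatched_good
  payoff_nonneg i' := by
    have : (0 : I → ℝ) ≤ Pi.single i c := Pi.single_nonneg.2 hc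
    exact add_nonneg (h.payoff_nonneg i') (this i')
  price_nonneg := h.price_nonneg

theorem Supports.shift_single {μ : I ≃. J} {W : Outcome I J} (h : M.Supports μ W)
    (hc : c ≤ W.payoff i) (hi : μ i ≠ none) :
    (M.shift (Pi.single i c)).Supports μ ⟨W.price, W.payoff - Pi.single i c⟩ where
  matched i' j hj := by
    simp only [Pi.sub_apply, h.matched i' j hj]
    rfl
  not_matched i' j hj := sub_le_sub_right (h.not_matched i' j hj) _
  unmatched_buyer i' hi' := by
    have : i' ≠ i := fun e => hi (e ▸ hi')
    simp [h.unmatched_buyer i' hi', this]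
  unmatched_good := h.unmatched_good
  payoff_nonneg i' := by
    rcases eq_or_ne i' i with rfl | hne
    · simpa using hc
    · simpa [hne] using h.payoff_nonneg i'
  price_nonneg := h.price_nonneg

/-- With an outside option at least as good as every purchase at these prices, buyer `i` may join
the market and stay unmatched. -/
theorem Supports.exists_extend {ν : {i' : I // i' ≠ i} ≃. J} {V : Outcome {i' : I // i' ≠ i} J}
    (h : (M.removeBuyer i).Supports ν V) (hc : ∀ j, M.utility i j (V.price j) ≤ c) :
    ∃ μ u, μ i = none ∧ u i = 0 ∧ (M.shift (Pi.single i c)).Supports μ ⟨V.price, u⟩ := by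
  obtain ⟨μ, hi, hμ, hμ'⟩ := ν.exists_extend
  refine ⟨μ, fun i' => if h : i' ≠ i then V.payoff ⟨i', h⟩ else 0, hi, by simp, ?_, ?_, ?_,
    fun j hj => h.unmatched_good j (hμ' j hj), ?_, h.price_nonneg⟩
  · intro i' j hj
    rcases eq_or_ne i' i with rfl | hne
    · simp [hi] at hj
    · simpa [hne, shift, removeBuyer] using h.matched ⟨i', hne⟩ j (hμ ⟨i', hne⟩ ▸ hj)
  · intro i' j hj
    rcases eq_or_ne i' i with rfl | hne
    · simpa [shift] using hc j
    · simpa [hne, shift, removeBuyer] using h.utility_le_payoff ⟨i', hne⟩ j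
  · intro i' hi'
    rcases eq_or_ne i' i with rfl | hne
    · simp
    · simpa [hne] using h.unmatched_buyer ⟨i', hne⟩ (hμ ⟨i', hne⟩ ▸ hi')
  · intro i'
    rcases eq_or_ne i' i with rfl | hne
    · simp
    · simpa [hne] using h.payoff_nonneg ⟨i', hne⟩

theorem Supports.exists_removeBuyer {μ : I ≃. J} {W : Outcome I J}
    (h : (M.shift (Pi.single i c)).Supports μ W) (hi : μ i = none) :
    ∃ V, (M.removeBuyer i).IsCompetitiveEquilibrium V ∧ V.price = W.price := by
  obtain ⟨ν, hν, hν'⟩ := PEquiv.exists_restrict hi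
  refine ⟨⟨W.price, fun i' => W.payoff i'⟩, ⟨ν, fun i' j hj => ?_, fun i' j hj => ?_,
    fun i' hi' => h.unmatched_buyer i' (hν i' ▸ hi'), fun j hj => h.unmatched_good j (hν' j hj),
    fun i' => h.payoff_nonneg i', h.price_nonneg⟩, rfl⟩
  · simpa [shift, removeBuyer, i'.2] using h.matched i' j (hν i' ▸ hj)
  · simpa [shift, removeBuyer, i'.2] using h.utility_le_payoff i' j

end RemoveBuyer

section InducedPayoff

variable [Finite J]

theorem utility_le_inducedPayoff (M : Market I J) (p : J → ℝ) (i : I) (j : J) :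
    M.utility i j (p j) ≤ M.inducedPayoff p i :=
  (M.isGreatest_inducedPayoff p i).2 (Or.inr ⟨j, rfl⟩)

theorem inducedPayoff_nonneg (M : Market I J) (p : J → ℝ) (i : I) : 0 ≤ M.inducedPayoff p i :=
  (M.isGreatest_inducedPayoff p i).2 (Or.inl rfl)

theorem inducedPayoff_anti (M : Market I J) {p q : J → ℝ} (h : p ≤ q) (i : I) :
    M.inducedPayoff q i ≤ M.inducedPayoff p i := by
  rcases (M.isGreatest_inducedPayoff q i).1 with h0 | ⟨j, hj⟩
  · exact h0 ▸ M.inducedPayoff_nonneg p i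
  · exact hj ▸ ((M.strictAnti_utility i j).antitone (h j)).trans (M.utility_le_inducedPayoff p i j)

end InducedPayoff

/-! ### The lowest equilibrium and the market without a buyer -/

section Finite

variable [Finite I] [Finite J] {M : Market I J} {i : I} {V : Outcome {i' : I // i' ≠ i} J}

/-- If the outside option of buyer `i` is slightly lower than the payoff induced by the highest
prices of the market without `i`, then `i` is matched in every equilibrium. In the limit, `i` is
matched in an equilibrium in which the outside option equals this payoff. -/
theorem exists_supports_shift [DecidableEq I] (hV : (M.removeBuyer i).IsHighest V)
    (h0 : 0 < M.inducedPayoff V.price i) :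
    ∃ μ W, μ i ≠ none ∧ (M.shift (Pi.single i (M.inducedPayoff V.price i))).Supports μ W := by
  set c := M.inducedPayoff V.price i with hc
  have hr : Continuous fun x : ℝ × (J → ℝ) => (Pi.single i (c - x.1) : I → ℝ) :=
    (continuous_single i).comp (continuous_const.sub continuous_fst)
  -- The option `c - 1` lies below all options `c - ε` with `ε ≤ 1`, so one box serves them all.
  obtain ⟨B, hB⟩ := M.exists_price_bound (Pi.single i (c - 1))
  obtain ⟨⟨μ, hi⟩, p, h⟩ := exists_mem_zero_of_pos (K := Set.Icc 0 fun _ => B)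
    (C := fun μ : {μ : I ≃. J // μ i ≠ none} =>
      {x : ℝ × (J → ℝ) | M.ApproxSupports (Pi.single i (c - x.1)) 0 μ x.2}) isCompact_Icc
    (fun μ => M.isClosed_setOf_approxSupports hr continuous_const continuous_snd μ)
    fun ε hε hε' => by
      obtain ⟨μ, p, h⟩ := M.exists_approxSupports (Pi.single i (c - ε))
      refine ⟨⟨μ, fun hi => ?_⟩, p, ⟨h.price_nonneg, hB _ 0 μ p ?_ h.toTentativelySupports⟩, h⟩
      -- If `i` were unmatched, `p` would be an equilibrium price vector without `i`, hence at most
      -- `V.price`; then `i` could buy a payoff of at least `c`, more than the option.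
      · obtain ⟨u, hu⟩ := h.exists_supports
        obtain ⟨V', hV', hp⟩ := hu.exists_removeBuyer hi
        have hle : p ≤ V.price := hp.symm.trans_le (hV.2 V' hV')
        obtain hc0 | ⟨j, hj⟩ := (M.isGreatest_inducedPayoff V.price i).1
        · exact h0.ne' hc0
        · have h1 := h.unmatched_buyer i hi j
          have h2 := (M.strictAnti_utility i j).antitone (hle j)
          simp only [add_zero, Pi.single_eq_same] at h1
          have h3 : M.utility i j (V.price j) = c := hj
          linarith
      · exact Pi.single_mono i (by linarith)
  replace h : M.ApproxSupports (Pi.single i (c - 0)) 0 μ p := h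
  rw [sub_zero] at h
  obtain ⟨u, hu⟩ := h.exists_supports
  exact ⟨μ, _, hi, hu⟩

/-- The highest prices of the market without buyer `i` are equilibrium prices of the market. -/
theorem exists_isCompetitiveEquilibrium_price_eq (hV : (M.removeBuyer i).IsHighest V) :
    ∃ W, M.IsCompetitiveEquilibrium W ∧ W.price = V.price := by
  classical
  obtain ⟨ν, hν⟩ := hV.1
  obtain ⟨ν', v, hν'i, hvi, hv⟩ := hν.exists_extend (M.utility_le_inducedPayoff V.price i)
  rcases (M.inducedPayoff_nonneg V.price i).eq_or_lt with h0 | h0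
  · rw [← h0, Pi.single_zero, shift_zero] at hv
    exact ⟨_, ⟨ν', hv⟩, rfl⟩
  obtain ⟨μ, W, hμi, hW⟩ := exists_supports_shift hV h0
  -- A buyer strictly better off in `W` would be matched by `ν'` too.
  have hWi : W.payoff i ≤ v i := by
    by_contra! hlt
    obtain ⟨j, hj, -⟩ := hW.exists_mem_of_payoff_lt_right hv hlt
    simp [hν'i] at hj
  have hle : W.price ≤ V.price := by
    -- The join led by `ν'` leaves `i` unmatched, so maximality of `V` bounds its prices.
    obtain ⟨ξ, hξ, hξ'⟩ := hv.join hW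
    have hξi := hξ i (hvi.trans_le (hW.payoff_nonneg i))
    obtain ⟨V', hV', hp⟩ := hξ'.exists_removeBuyer (hξi.trans hν'i)
    exact le_sup_right.trans (hp ▸ hV.2 V' hV')
  -- With the order reversed, the join follows `μ` at `i`: the prices are those of `V`, but now `i`
  -- is matched and the option can be dropped.
  obtain ⟨ξ, hξ, hξ'⟩ := hW.join hv
  exact ⟨_, ⟨ξ, hξ'.of_shift_single h0.le (by rwa [hξ i hWi])⟩, sup_eq_right.2 hle⟩

namespace IsLowest

variable {W : Outcome I J}

theorem price_le_price_removeBuyer (hW : M.IsLowest W) (hV : (M.removeBuyer i).IsHighest V) :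
    W.price ≤ V.price := by
  obtain ⟨W', hW', hp⟩ := exists_isCompetitiveEquilibrium_price_eq hV
  exact hp ▸ hW.2 W' hW'

theorem payoff_eq (hW : M.IsLowest W) (hV : (M.removeBuyer i).IsHighest V) :
    W.payoff i = M.inducedPayoff V.price i := by
  classical
  obtain ⟨μ, hμ⟩ := hW.1
  obtain ⟨ν, hν⟩ := hV.1
  refine le_antisymm ?_ ?_
  · by_contra! hlt
    have hi : μ i ≠ none := fun hi =>
      ((M.inducedPayoff_nonneg V.price i).trans_lt hlt).ne' (hμ.unmatched_buyer i hi)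
    obtain ⟨ν', v, hν'i, hvi, hv⟩ := hν.exists_extend (M.utility_le_inducedPayoff V.price i)
    -- With option `c`, buyer `i` would strictly prefer `W` to the extension of `V`, and so be
    -- matched in the latter.
    obtain ⟨j, hj, -⟩ := (hμ.shift_single hlt.le hi).exists_mem_of_payoff_lt_right hv
      (i := i) (by simpa [hvi] using hlt)
    simp [hν'i] at hj
  · rw [hμ.payoff_eq_inducedPayoff]
    exact M.inducedPayoff_anti (hW.price_le_price_removeBuyer hV) i

theorem price_eq (hW : M.IsLowest W) (hV : (M.removeBuyer i).IsHighest V) {μ : I ≃. J}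
    (hμ : M.Supports μ W) {j : J} (hj : j ∈ μ i) : W.price j = V.price j := by
  classical
  refine (hW.price_le_price_removeBuyer hV j).eq_of_not_lt fun hlt => ?_
  obtain ⟨ν, hν⟩ := hV.1
  obtain ⟨ν', v, hν'i, hvi, hv⟩ := hν.exists_extend (M.utility_le_inducedPayoff V.price i)
  have hi : μ i ≠ none := fun h => by simp [h] at hj
  -- The owner of a cheaper good strictly prefers `W`, but that owner is `i`, whose shifted payoff
  -- is `0` in both.
  obtain ⟨i', hi', hlt'⟩ := (hμ.shift_single (hW.payoff_eq hV).ge hi).exists_mem_of_price_lt_left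
    hv hlt
  obtain rfl := μ.inj hi' hj
  simp [hvi, hW.payoff_eq hV] at hlt'

end IsLowest

end Finite

/-! ### Exchanging buyers and goods -/

section Duality

variable {M : Market I J} {W : Outcome I J}

theorem isCompetitiveEquilibrium_dual_swap :
    M.dual.IsCompetitiveEquilibrium W.swap ↔ M.IsCompetitiveEquilibrium W :=
  ⟨fun ⟨ν, h⟩ => ⟨ν.symm, h.of_dual⟩, fun ⟨μ, h⟩ => ⟨μ.symm, h.dual⟩⟩

theorem IsCompetitiveEquilibrium.payoff_eq [Finite J] (h : M.IsCompetitiveEquilibrium W) :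
    W.payoff = M.inducedPayoff W.price := by
  obtain ⟨μ, hμ⟩ := h
  exact funext hμ.payoff_eq_inducedPayoff

theorem IsCompetitiveEquilibrium.price_eq [Finite I] (h : M.IsCompetitiveEquilibrium W) :
    W.price = M.inducedPrice W.payoff :=
  (isCompetitiveEquilibrium_dual_swap.2 h).payoff_eq

variable [Finite I] [Finite J]

/-- In equilibrium, prices and payoffs determine each other by antitone maps; hence duality
exchanges lowest and highest. -/
theorem IsCompetitiveEquilibrium.payoff_le_iff {W' : Outcome I J}
    (h : M.IsCompetitiveEquilibrium W) (h' : M.IsCompetitiveEquilibrium W') :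
    W.payoff ≤ W'.payoff ↔ W'.price ≤ W.price := by
  refine ⟨fun hle j => ?_, fun hle i => ?_⟩
  · rw [h.price_eq, h'.price_eq]
    exact M.dual.inducedPayoff_anti hle j
  · rw [h.payoff_eq, h'.payoff_eq]
    exact M.inducedPayoff_anti hle i

theorem isHighest_dual_swap : M.dual.IsHighest W.swap ↔ M.IsLowest W := by
  refine ⟨fun h => ?_, fun h => ?_⟩
  · have hW := isCompetitiveEquilibrium_dual_swap.1 h.1
    exact ⟨hW, fun W' hW' =>
      (hW'.payoff_le_iff hW).1 (h.2 W'.swap (isCompetitiveEquilibrium_dual_swap.2 hW'))⟩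
  · exact ⟨isCompetitiveEquilibrium_dual_swap.2 h.1, fun W' hW' =>
      have hW'' := isCompetitiveEquilibrium_dual_swap (W := W'.swap).1 hW'
      (hW''.payoff_le_iff h.1).2 (h.2 _ hW'')⟩

theorem isLowest_dual_swap : M.dual.IsLowest W.swap ↔ M.IsHighest W := by
  refine ⟨fun h => ?_, fun h => ?_⟩
  · have hW := isCompetitiveEquilibrium_dual_swap.1 h.1
    exact ⟨hW, fun W' hW' =>
      (hW.payoff_le_iff hW').1 (h.2 W'.swap (isCompetitiveEquilibrium_dual_swap.2 hW'))⟩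
  · exact ⟨isCompetitiveEquilibrium_dual_swap.2 h.1, fun W' hW' =>
      have hW'' := isCompetitiveEquilibrium_dual_swap (W := W'.swap).1 hW'
      (h.1.payoff_le_iff hW'').2 (h.2 _ hW'')⟩

theorem exists_isLowest (M : Market I J) : ∃ W, M.IsLowest W :=
  have ⟨W, hW⟩ := M.dual.exists_isHighest
  ⟨W.swap, isHighest_dual_swap.1 hW⟩

omit [Finite I] in
theorem IsLowest.unique {W' : Outcome I J} (h : M.IsLowest W) (h' : M.IsLowest W') : W = W' := by
  have hp : W.price = W'.price := le_antisymm (h.2 _ h'.1) (h'.2 _ h.1)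
  exact Outcome.ext hp (by rw [h.1.payoff_eq, h'.1.payoff_eq, hp])

/-- For the converse: the formulas determine the outcome, and the existing lowest equilibrium
satisfies them. -/
theorem isLowest_iff {V : (i : I) → Outcome {i' : I // i' ≠ i} J}
    (hV : ∀ i, (M.removeBuyer i).IsHighest (V i)) :
    M.IsLowest W ↔ (∀ i, W.payoff i = M.inducedPayoff (V i).price i) ∧
      ∀ j, W.price j = M.inducedPrice W.payoff j := by
  refine ⟨fun h => ⟨fun i => h.payoff_eq (hV i), congrFun h.1.price_eq⟩, fun ⟨hu, hp⟩ => ?_⟩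
  obtain ⟨W', hW'⟩ := M.exists_isLowest
  have hu' : W.payoff = W'.payoff := funext fun i => (hu i).trans (hW'.payoff_eq (hV i)).symm
  have hp' : W.price = W'.price := by rw [hW'.1.price_eq, ← hu', funext hp]
  rwa [Outcome.ext hp' hu']

end Duality

end Market

/-- Existence of competitive equilibria, and the inductive characterization of the lowest and the
highest one. -/
theorem mainTheorem1 {I J : Type*} [Finite I] [Finite J] (M : Market I J) :
    -- a competitive equilibrium, a unique lowest one and a unique highest one exist
    (∃ W, M.IsCompetitiveEquilibrium W) ∧ (∃! W, M.IsLowest W) ∧ (∃! W, M.IsHighest W) ∧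
    -- (I)
    (∀ W, M.IsLowest W → ∀ i, ∀ V, (M.removeBuyer i).IsHighest V →
      W.payoff i = M.inducedPayoff V.price i) ∧
    -- (II)
    (∀ W, M.IsHighest W → ∀ j, ∀ V, (M.removeGood j).IsLowest V →
      W.price j = M.inducedPrice V.payoff j) ∧
    -- (I) and (II) fully characterize the lowest and the highest equilibrium
    (∀ V : (i : I) → Outcome {i' : I // i' ≠ i} J, (∀ i, (M.removeBuyer i).IsHighest (V i)) →
      ∀ W, M.IsLowest W ↔
        (∀ i, W.payoff i = M.inducedPayoff (V i).price i) ∧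
          ∀ j, W.price j = M.inducedPrice W.payoff j) ∧
    (∀ V : (j : J) → Outcome I {j' : J // j' ≠ j}, (∀ j, (M.removeGood j).IsLowest (V j)) →
      ∀ W, M.IsHighest W ↔
        (∀ j, W.price j = M.inducedPrice (V j).payoff j) ∧
          ∀ i, W.payoff i = M.inducedPayoff W.price i) ∧
    -- (III)
    (∀ W, M.IsLowest W → ∀ i, ∀ V, (M.removeBuyer i).IsHighest V → ∀ j,
      W.price j ≤ V.price j ∧
        ∀ μ : I ≃. J, M.Supports μ W → j ∈ μ i → W.price j = V.price j) ∧
    -- (IV)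
    (∀ W, M.IsHighest W → ∀ j, ∀ V, (M.removeGood j).IsLowest V → ∀ i,
      W.payoff i ≤ V.payoff i ∧
        ∀ μ : I ≃. J, M.Supports μ W → j ∈ μ i → W.payoff i = V.payoff i) := by
  obtain ⟨L, hL⟩ := M.exists_isLowest
  obtain ⟨H, hH⟩ := M.exists_isHighest
  -- Removing a good and then dualizing is definitionally the same as dualizing and then removing a
  -- buyer.
  have hd : ∀ {j} {V : Outcome I {j' : J // j' ≠ j}}, (M.removeGood j).IsLowest V →
      (M.dual.removeBuyer j).IsHighest V.swap := fun hV => Market.isHighest_dual_swap.2 hV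
  refine ⟨⟨L, hL.1⟩, ⟨L, hL, fun W hW => hW.unique hL⟩, ⟨H, hH, fun W hW => ?_⟩,
    fun W hW i V hV => hW.payoff_eq hV,
    fun W hW j V hV => (Market.isLowest_dual_swap.2 hW).payoff_eq (hd hV),
    fun V hV W => Market.isLowest_iff hV, fun V hV W => ?_,
    fun W hW i V hV j => ⟨hW.price_le_price_removeBuyer hV j, fun μ hμ hj => hW.price_eq hV hμ hj⟩,
    fun W hW j V hV i => ⟨(Market.isLowest_dual_swap.2 hW).price_le_price_removeBuyer (hd hV) i,
      fun μ hμ hj => (Market.isLowest_dual_swap.2 hW).price_eq (hd hV) hμ.dual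
        ((μ.mem_iff_mem).2 hj)⟩⟩
  · exact congrArg Outcome.swap
      ((Market.isLowest_dual_swap.2 hW).unique (Market.isLowest_dual_swap.2 hH))
  · rw [← Market.isLowest_dual_swap, Market.isLowest_iff fun j => hd (hV j)]
    simp only [Market.inducedPrice_dual]
    rfl
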